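/- Fix a dimension $d \ge 1$ and radii $0 < r_n < 1/4$, and let $\mu_n = n \phi_d r_n^d$, where $\phi_d$ is the volume of the Euclidean unit ball of $\mathbb R^d$. The hard random geometric graph $G(n,r_n)$ has vertex set $V = \{1,\dots,N_n\}$ with $N_n$ Poisson of mean $n$; its vertices have independent positions, uniform on $[0,1]^d$ and independent of $N_n$, and two vertices are adjacent when their distance on the torus is at most $r_n$. Let $k_n \ge 2$ be integers with $\mathbb P(N_n \ge k_n) \to 1$. The graph $G_{k_n}(n,r_n)$ arises from $G(n,r_n)$ by choosing a set $K_n$ of $k_n$ vertices uniformly at random, independently of the positions, and adding all missing edges inside $K_n$. The vertex-degree (VD) algorithm outputs $k_n$ vertices of largest degree in $G_{k_n}(n,r_n)$. It is said to recover the planted clique with high probability if the probability that its output, however ties are broken, is exactly $K_n$ tends to $1$ as $n \to \infty$. Let $H(x) = 1 - x + x\log x$, with $H(0)=1$, let $H_+^{-1}$ be the inverse of $H$ on $[1,\infty)$ and $H_-^{-1}$ the inverse of $H$ on $[0,1]$; equivalently, $H_+^{-1}(y) = \exp\{W_0((y-1)/e)+1\}$ for $y \ge 0$, and $H_-^{-1}(y)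 = \exp\{W_{-1}((y-1)/e)+1\}$ for $0 \le y < 1$, $H_-^{-1}(1) = 0$, with the two real branches $W_0, W_{-1}$ of the Lambert function. Assume that $\mu_n/\log n \to \alpha \in [0,\infty]$. If $\alpha<\infty$, put $$T(n) = \begin{cases} \dfrac{\log n}{\log(\log (n)/\mu_n)} & \text{if } \alpha = 0,\\ \mu_n H_+^{-1}(\alpha^{-1}) & \text{if } \alpha \in (0,\infty),\end{cases} \qquad t(n) = \begin{cases} 0 & \text{if } \alpha \in [0,1),\\ \mu_n H_-^{-1}(\alpha^{-1}) & \text{if } \alpha \in [1,\infty).\end{cases}$$ Let $\varepsilon > 0$. 1. If $\alpha \in [0,\infty)$ and $k_n > (1+\varepsilon)(T(n)-t(n))$ for all large $n$, then the VD-algorithm recovers the planted clique with high probability; in the case $\alpha = 0$ it is assumed in addition that $k_n \to \infty$ or that even $k_n - 1 > (1+\varepsilon)(T(n)-t(n))$ for all large $n$. 2. If $\alpha = \infty$ and $k_n > \varepsilon\mu_n$ for all large $n$, then the VD-algorithm recovers the planted clique with high probability. -/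

import Mathlib

open Filter Topology MeasureTheory
open scoped ENNReal NNReal

noncomputable section

namespace PlantedRGG

/-! ### The planted hard random geometric graph on the torus -/

/-- The toroidal (Euclidean) distance between two points of the unit cube `[0,1]^d`. -/
def torusDist {d : ℕ} (x y : Fin d → ℝ) : ℝ :=
  Real.sqrt (∑ i, (min |x i - y i| (1 - |x i - y i|)) ^ 2)

/-- The hard geometric graph on the points `x 0, …, x (m-1)` of the torus: two distinct vertices
are adjacent when their toroidal distance is at most `r`. -/
def geomGraph {d m : ℕ} (r : ℝ) (x : Fin m → Fin d → ℝ) : SimpleGraph (Fin m) where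
  Adj i j := i ≠ j ∧ torusDist (x i) (x j) ≤ r
  symm := ⟨fun i j h => ⟨h.1.symm, by
    have e : torusDist (x j) (x i) = torusDist (x i) (x j) := by
      simp only [torusDist, abs_sub_comm]
    exact e.trans_le h.2⟩⟩
  loopless := ⟨fun _ h => h.1 rfl⟩

/-- The graph obtained from `G` by adding all missing edges between vertices of `K`. -/
def plantClique {V : Type*} (G : SimpleGraph V) (K : Finset V) : SimpleGraph V where
  Adj i j := G.Adj i j ∨ (i ≠ j ∧ i ∈ K ∧ j ∈ K)
  symm := ⟨fun _ _ h => h.imp (fun a => a.symm) (fun a => ⟨a.1.symm, a.2.2, a.2.1⟩)⟩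
  loopless := ⟨fun _ h => h.elim (fun a => G.irrefl a) (fun a => a.1 rfl)⟩

/-- The volume `φ_d` of the Euclidean unit ball of dimension `d`. -/
def ballVolume (d : ℕ) : ℝ :=
  (volume (Metric.ball (0 : EuclideanSpace ℝ (Fin d)) 1)).toReal

/-- The expected degree `μ_n = n φ_d r_n ^ d`. -/
def meanDegree (d : ℕ) (r : ℕ → ℝ) (n : ℕ) : ℝ :=
  n * ballVolume d * r n ^ d

/-- The law of `m` independent uniformly distributed points of `[0,1]^d`. -/
def positionLaw (d m : ℕ) : Measure (Fin m → Fin d → ℝ) :=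
  Measure.pi fun _ => volume.restrict (Set.Icc 0 1)

/-- The outcomes of the model: a number `m` of vertices, the positions of the `m` vertices, and
a set of vertices. -/
abbrev Outcome (d : ℕ) : Type := Σ m : ℕ, (Fin m → Fin d → ℝ) × Finset (Fin m)

/-- The joint law of the number `N` of vertices, the positions and the planted set `K`: `N` is
Poisson with mean `n`; given `N = m`, the positions are independent and uniform on `[0,1]^d` and,
independently of them, `K` is uniform among the sets of `k` vertices.
There is no such set when `m < k`, and such `m` contribute nothing, so that the total mass is
the probability that `N ≥ k`. -/
def plantedLaw (d n k : ℕ) : Measure (Outcome d) :=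
  Measure.sum fun m : ℕ =>
    ProbabilityTheory.poissonMeasure (n : ℝ≥0) {m} •
      ((positionLaw d m).prod
        (ProbabilityTheory.uniformOn
          (↑(Finset.powersetCard k (Finset.univ : Finset (Fin m))) : Set (Finset (Fin m))))).map
        (Sigma.mk m)

/-! ### The vertex-degree algorithm -/

/-- The number of neighbours of a vertex. -/
def deg {m : ℕ} (G : SimpleGraph (Fin m)) (i : Fin m) : ℕ := (G.neighborSet i).ncard

/-- `S` is a possible output of the vertex-degree algorithm on the input `(G, k)`: it consists of
`k` vertices with the largest degrees (ties may be broken in any way). -/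
def IsVDOutput {m : ℕ} (G : SimpleGraph (Fin m)) (k : ℕ) (S : Finset (Fin m)) : Prop :=
  S.card = k ∧ ∀ i ∈ S, ∀ j ∉ S, deg G j ≤ deg G i

/-- The event that the vertex-degree algorithm, run on the geometric graph of radius `r` with the
planted clique, outputs the planted clique, however ties are broken. -/
def recoveryEvent (d : ℕ) (r : ℝ) (k : ℕ) : Set (Outcome d) :=
  {ω | ∀ S : Finset (Fin ω.1),
    IsVDOutput (plantClique (geomGraph r ω.2.1) ω.2.2) k S ↔ S = ω.2.2}

/-- Exact recovery with high probability by the vertex-degree algorithm. -/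
def VDRecovers (d : ℕ) (r : ℕ → ℝ) (k : ℕ → ℕ) : Prop :=
  Tendsto (fun n => plantedLaw d n (k n) (recoveryEvent d (r n) (k n))) atTop (𝓝 1)

/-- With high probability there are at least `k_n` vertices, so that a clique of size `k_n` can
be planted. -/
def Plantable (k : ℕ → ℕ) : Prop :=
  Tendsto (fun n : ℕ => ProbabilityTheory.poissonMeasure (n : ℝ≥0) {m | k n ≤ m}) atTop (𝓝 1)

/-! ### The asymptotic maximum and minimum degrees -/

/-- The function `H(x) = 1 - x + x log x`. -/
def entropyH (x : ℝ) : ℝ := 1 - x + x * Real.log x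

/-- The inverse of `H` on `[1,∞)`, defined for `y ≥ 0`. -/
def HinvPlus (y : ℝ) : ℝ := Function.invFunOn entropyH (Set.Ici 1) y

/-- The inverse of `H` on `[0,1]`, defined for `0 ≤ y ≤ 1`. -/
def HinvMinus (y : ℝ) : ℝ := Function.invFunOn entropyH (Set.Icc 0 1) y

/-- The asymptotic maximum degree `T(n)`, as a function of `α < ∞`, `μ_n` and `n`. -/
def maxDegAsymp (α μ : ℝ) (n : ℕ) : ℝ :=
  if α = 0 then Real.log n / Real.log (Real.log n / μ) else μ * HinvPlus α⁻¹

/-- The asymptotic minimum degree `t(n)`, as a function of `α < ∞` and `μ_n`. -/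
def minDegAsymp (α μ : ℝ) : ℝ :=
  if α < 1 then 0 else μ * HinvMinus α⁻¹

/-! The two branches of the Lambert function, and the resulting formulas for the inverses of
`H`. -/

/-- The branch `W₀`, defined for `z ≥ -1/e`. -/
def lambertW0 (z : ℝ) : ℝ := Function.invFunOn (fun w => w * Real.exp w) (Set.Ici (-1)) z

/-- The branch `W₋₁`, defined for `-1/e ≤ z < 0`. -/
def lambertWm1 (z : ℝ) : ℝ := Function.invFunOn (fun w => w * Real.exp w) (Set.Iic (-1)) z

theorem entropyH_exp (w : ℝ) :
    entropyH (Real.exp (w + 1)) = 1 + Real.exp 1 * (w * Real.exp w) := by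
  rw [entropyH, Real.log_exp, Real.exp_add]
  ring

theorem entropyH_eq : entropyH = InformationTheory.klFun := by
  funext x
  simp only [entropyH, InformationTheory.klFun]
  ring

theorem strictMonoOn_entropyH : StrictMonoOn entropyH (Set.Ici 1) := by
  rw [entropyH_eq]
  refine strictMonoOn_of_deriv_pos (convex_Ici 1)
    InformationTheory.continuous_klFun.continuousOn fun x hx => ?_
  rw [interior_Ici] at hx
  rw [InformationTheory.deriv_klFun]
  exact Real.log_pos hx

theorem strictAntiOn_entropyH : StrictAntiOn entropyH (Set.Icc 0 1) := by
  rw [entropyH_eq]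
  refine strictAntiOn_of_deriv_neg (convex_Icc 0 1)
    InformationTheory.continuous_klFun.continuousOn fun x hx => ?_
  rw [interior_Icc] at hx
  rw [InformationTheory.deriv_klFun]
  exact Real.log_neg hx.1 hx.2

theorem HinvPlus_spec {y : ℝ} (hy : 0 ≤ y) : 1 ≤ HinvPlus y ∧ entropyH (HinvPlus y) = y := by
  have h : ∃ a ∈ Set.Ici (1 : ℝ), entropyH a = y := by
    rw [entropyH_eq]
    have hc : Set.Ici (InformationTheory.klFun 1) ⊆ InformationTheory.klFun '' Set.Ici 1 :=
      isPreconnected_Ici.intermediate_value_Ici Set.self_mem_Ici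
        (le_principal_iff.2 (Ici_mem_atTop 1))
        InformationTheory.continuous_klFun.continuousOn InformationTheory.tendsto_klFun_atTop
    rw [InformationTheory.klFun_one] at hc
    exact hc hy
  exact ⟨Function.invFunOn_mem h, Function.invFunOn_eq h⟩

theorem HinvMinus_spec {y : ℝ} (hy : 0 ≤ y) (hy1 : y ≤ 1) :
    HinvMinus y ∈ Set.Icc (0 : ℝ) 1 ∧ entropyH (HinvMinus y) = y := by
  have h : ∃ a ∈ Set.Icc (0 : ℝ) 1, entropyH a = y := by
    rw [entropyH_eq]
    have hc := intermediate_value_Icc' (zero_le_one (α := ℝ))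
      (InformationTheory.continuous_klFun.continuousOn (s := Set.Icc 0 1))
    rw [InformationTheory.klFun_one, InformationTheory.klFun_zero] at hc
    exact hc ⟨hy, hy1⟩
  exact ⟨Function.invFunOn_mem h, Function.invFunOn_eq h⟩

theorem HinvPlus_eq_lambert {y : ℝ} (hy : 0 ≤ y) :
    HinvPlus y = Real.exp (lambertW0 ((y - 1) / Real.exp 1) + 1) := by
  obtain ⟨h1, h2⟩ := HinvPlus_spec hy
  have hpos : 0 < HinvPlus y := by linarith
  have key : ∀ w : ℝ, w * Real.exp w = (y - 1) / Real.exp 1 →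
      entropyH (Real.exp (w + 1)) = y := fun w hw => by
    rw [entropyH_exp, hw, mul_div_cancel₀ _ (Real.exp_pos 1).ne']; ring
  have h : ∃ a ∈ Set.Ici (-1 : ℝ), (fun w => w * Real.exp w) a = (y - 1) / Real.exp 1 := by
    refine ⟨Real.log (HinvPlus y) - 1, ?_, ?_⟩
    · have := Real.log_nonneg h1
      simp only [Set.mem_Ici]; linarith
    · have e := entropyH_exp (Real.log (HinvPlus y) - 1)
      rw [sub_add_cancel, Real.exp_log hpos, h2] at e
      rw [eq_div_iff (Real.exp_pos 1).ne']
      simp only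
      linarith
  have hm : lambertW0 ((y - 1) / Real.exp 1) ∈ Set.Ici (-1 : ℝ) := Function.invFunOn_mem h
  have he := key (lambertW0 ((y - 1) / Real.exp 1)) (Function.invFunOn_eq h)
  refine strictMonoOn_entropyH.injOn h1 ?_ (h2.trans he.symm)
  simp only [Set.mem_Ici] at hm ⊢
  exact Real.one_le_exp (by linarith)

theorem HinvMinus_eq_lambert {y : ℝ} (hy : 0 ≤ y) (hy1 : y < 1) :
    HinvMinus y = Real.exp (lambertWm1 ((y - 1) / Real.exp 1) + 1) := by
  obtain ⟨h1, h2⟩ := HinvMinus_spec hy hy1.le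
  have hpos : 0 < HinvMinus y := by
    rcases h1.1.lt_or_eq with h | h
    · exact h
    · rw [← h] at h2
      simp only [entropyH, zero_mul, sub_zero, add_zero] at h2
      exact absurd h2 (by linarith)
  have key : ∀ w : ℝ, w * Real.exp w = (y - 1) / Real.exp 1 →
      entropyH (Real.exp (w + 1)) = y := fun w hw => by
    rw [entropyH_exp, hw, mul_div_cancel₀ _ (Real.exp_pos 1).ne']; ring
  have h : ∃ a ∈ Set.Iic (-1 : ℝ), (fun w => w * Real.exp w) a = (y - 1) / Real.exp 1 := by
    refine ⟨Real.log (HinvMinus y) - 1, ?_, ?_⟩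
    · have := Real.log_nonpos hpos.le h1.2
      simp only [Set.mem_Iic]; linarith
    · have e := entropyH_exp (Real.log (HinvMinus y) - 1)
      rw [sub_add_cancel, Real.exp_log hpos, h2] at e
      rw [eq_div_iff (Real.exp_pos 1).ne']
      simp only
      linarith
  have hm : lambertWm1 ((y - 1) / Real.exp 1) ∈ Set.Iic (-1 : ℝ) := Function.invFunOn_mem h
  have he := key (lambertWm1 ((y - 1) / Real.exp 1)) (Function.invFunOn_eq h)
  refine strictAntiOn_entropyH.injOn h1 ?_ (h2.trans he.symm)
  simp only [Set.mem_Iic] at hm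
  exact ⟨(Real.exp_pos _).le, Real.exp_le_one_iff.2 (by linarith)⟩

theorem HinvMinus_one : HinvMinus 1 = 0 := by
  obtain ⟨h1, h2⟩ := HinvMinus_spec zero_le_one le_rfl
  refine strictAntiOn_entropyH.injOn h1 ⟨le_rfl, zero_le_one⟩ (h2.trans ?_)
  simp [entropyH]

end PlantedRGG

end

namespace PlantedRGG

/-! ### Volumes of balls on the torus -/

/-! A vertex outside the planted set `K` keeps its geometric degree, while a vertex of `K` has
degree at least `k - 1` plus its number of neighbours outside `K`. Hence, for any thresholds with `s
≤ k - 1 + u`, the algorithm can fail only if some vertex has at least `s` geometric neighbours or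
some vertex of `K` has at most `u` outer neighbours. The first event does not involve `K`, and the
second is bounded for each fixed `K`, which is independent of the positions.

Both events are controlled by Chernoff bounds. On the torus every ball of radius `r` has volume `p =
φ_d r^d`, so, given the position of a vertex, its neighbours among other vertices are counted by a
binomial variable with parameter `p` (`lintegral_prod_torusDist`). Averaging the union bound over
the Poisson number of vertices turns the binomial moments into Poisson ones. With `s = xμ` and the
optimal parameter `log x`, the bound is `exp (log n - μ H(x))`, which is why `H` and its two
inverses appear. For the lower tail only `m - k` vertices count, which costs a factor `(1 - q)⁻¹ ^
k`. The results are `plantedLaw_failure_le_of_le` (upper tail alone) and `plantedLaw_failure_le`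
(both tails).

What remains is the choice of thresholds. If `0 < α < ∞`, take `s = A'μ` and `u = a'μ`, with `A'`
just above and `a'` just below the values where `H` equals `1/α`; the factor `1 + ε` pays for both
shifts. If `α = ∞`, take `s = (1 + δ)μ`: fluctuations of order `δμ` are already unlikely. If `α =
0`, take `s = k - 1`: the upper tail alone suffices. -/

theorem norm_unitAddCircle_coe {a : ℝ} (ha : |a| ≤ 1) :
    ‖(a : UnitAddCircle)‖ = min |a| (1 - |a|) := by
  rw [UnitAddCircle.norm_eq, abs_sub_round_eq_min]
  rcases ha.lt_or_eq with h | h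
  · rcases le_or_gt 0 a with h0 | h0
    · rw [abs_of_nonneg h0] at h ⊢
      rw [Int.fract_eq_self.2 ⟨h0, h⟩]
    · rw [abs_of_neg h0] at h ⊢
      have : Int.fract a = a + 1 := by
        rw [← Int.fract_add_one]
        exact Int.fract_eq_self.2 ⟨by linarith, by linarith⟩
      rw [this, min_comm]
      congr 1 <;> ring
  · have : Int.fract a = 0 := by
      rcases (abs_eq zero_le_one).1 h with h' | h' <;> simp [h']
    rw [this, h]
    simp

/-- The Euclidean size of a point of the torus `(ℝ/ℤ)^d`. -/
noncomputable def torusNorm {d : ℕ} (c : Fin d → UnitAddCircle) : ℝ := Real.sqrt (∑ i, ‖c i‖ ^ 2)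

theorem continuous_torusNorm {d : ℕ} : Continuous (torusNorm (d := d)) := by
  unfold torusNorm
  fun_prop

theorem torusDist_eq_torusNorm {d : ℕ} {x y : Fin d → ℝ} (hx : x ∈ Set.Icc 0 1)
    (hy : y ∈ Set.Icc 0 1) :
    torusDist x y = torusNorm fun i => (y i : UnitAddCircle) - (x i : UnitAddCircle) := by
  rw [torusDist, torusNorm]
  congr 1
  refine Finset.sum_congr rfl fun i _ => ?_
  have h : |x i - y i| ≤ 1 := by
    have h1 := hx.1 i; have h2 := hx.2 i; have h3 := hy.1 i; have h4 := hy.2 i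
    simp only [Pi.zero_apply, Pi.one_apply] at h1 h2 h3 h4
    rw [abs_le]; constructor <;> linarith
  rw [norm_sub_rev, ← AddCircle.coe_sub, norm_unitAddCircle_coe h]

theorem continuous_torusDist {d : ℕ} :
    Continuous fun z : (Fin d → ℝ) × (Fin d → ℝ) => torusDist z.1 z.2 := by
  unfold torusDist
  fun_prop

theorem measurePreserving_pi_coe (d : ℕ) (a : ℝ) :
    MeasurePreserving (fun (x : Fin d → ℝ) i => (x i : UnitAddCircle))
      (volume.restrict (Set.pi Set.univ fun _ => Set.Ioc a (a + 1))) volume := by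
  have h := measurePreserving_pi (fun _ : Fin d => volume.restrict (Set.Ioc a (a + 1)))
    (fun _ => (volume : Measure UnitAddCircle)) fun _ => UnitAddCircle.measurePreserving_mk a
  rw [volume_pi, Measure.restrict_pi_pi]
  exact h

theorem volume_restrict_cube_eq (d : ℕ) :
    (volume : Measure (Fin d → ℝ)).restrict (Set.Icc 0 1) =
      volume.restrict (Set.pi Set.univ fun _ => Set.Ioc (0 : ℝ) (0 + 1)) := by
  refine Measure.restrict_congr_set ?_
  have := Measure.univ_pi_Ioc_ae_eq_Icc (μ := fun _ : Fin d => (volume : Measure ℝ))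
    (f := fun _ => 0) (g := fun _ => 1)
  rw [zero_add]
  exact this.symm

/-- The cube `(-1/2, 1/2]^d` is a fundamental domain on which the torus norm is the Euclidean norm,
and `r < 1/2` keeps the Euclidean ball inside it. -/
theorem volume_torusNorm_le (d : ℕ) {r : ℝ} (hr : 0 ≤ r) (hr2 : r < 1 / 2) :
    volume {c : Fin d → UnitAddCircle | torusNorm c ≤ r} =
      ENNReal.ofReal (ballVolume d * r ^ d) := by
  have hm : MeasurableSet {c : Fin d → UnitAddCircle | torusNorm c ≤ r} :=
    measurableSet_le continuous_torusNorm.measurable measurable_const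
  rw [← (measurePreserving_pi_coe d (-(1 / 2))).measure_preimage hm.nullMeasurableSet]
  have hs : Metric.closedBall (0 : EuclideanSpace ℝ (Fin d)) r = WithLp.ofLp ⁻¹'
      ((fun (x : Fin d → ℝ) i => (x i : UnitAddCircle)) ⁻¹' {c | torusNorm c ≤ r} ∩
        Set.pi Set.univ fun _ => Set.Ioc (-(1 / 2) : ℝ) (-(1 / 2) + 1)) := by
    have key : ∀ x : EuclideanSpace ℝ (Fin d), (∀ i, |x i| ≤ 1 / 2) →
        torusNorm (fun i => (x i : UnitAddCircle)) = ‖x‖ := fun x hx => by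
      rw [torusNorm, EuclideanSpace.norm_eq]
      congr 1
      refine Finset.sum_congr rfl fun i _ => ?_
      rw [norm_unitAddCircle_coe ((hx i).trans (by norm_num)), min_eq_left, Real.norm_eq_abs]
      linarith [hx i]
    ext x
    simp only [Metric.mem_closedBall, dist_zero_right, Set.mem_preimage, Set.mem_inter_iff,
      Set.mem_ofPred_eq, Set.mem_univ_pi, Set.mem_Ioc]
    constructor
    · intro h
      have hx : ∀ i, |x i| ≤ r := fun i => by
        rw [← Real.norm_eq_abs]
        exact (PiLp.norm_apply_le x i).trans h
      refine ⟨(key x fun i => (hx i).trans hr2.le).trans_le h, fun i => ?_⟩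
      have := abs_le.1 (hx i)
      constructor <;> linarith
    · rintro ⟨h, hx⟩
      rwa [key x fun i => abs_le.2 ⟨(hx i).1.le, by linarith [(hx i).2]⟩] at h
  have hme : MeasurableSet ((fun (x : Fin d → ℝ) i => (x i : UnitAddCircle)) ⁻¹'
      {c | torusNorm c ≤ r}) := (measurePreserving_pi_coe d (-(1 / 2))).measurable hm
  rw [Measure.restrict_apply hme, ← (PiLp.volume_preserving_ofLp (Fin d)).measure_preimage
    (hme.inter (MeasurableSet.univ_pi fun _ => measurableSet_Ioc)).nullMeasurableSet, ← hs,
    Measure.addHaar_closedBall _ _ hr, ballVolume, mul_comm, ENNReal.ofReal_mul ENNReal.toReal_nonneg,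
    ENNReal.ofReal_toReal measure_ball_lt_top.ne]
  simp

/-- Translation invariance of Haar measure on `(ℝ/ℤ)^d` reduces the claim to balls around the
origin. Since the volume does not depend on the centre, neighbour counts are binomial. -/
theorem volume_torusDist_le {d : ℕ} {x : Fin d → ℝ} (hx : x ∈ Set.Icc 0 1) {r : ℝ} (hr : 0 ≤ r)
    (hr2 : r < 1 / 2) :
    volume.restrict (Set.Icc 0 1) {y | torusDist x y ≤ r} =
      ENNReal.ofReal (ballVolume d * r ^ d) := by
  rw [← volume_torusNorm_le d hr hr2]
  have hm : MeasurableSet {c : Fin d → UnitAddCircle | torusNorm c ≤ r} :=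
    measurableSet_le continuous_torusNorm.measurable measurable_const
  have hsub := (measurePreserving_sub_right (volume : Measure (Fin d → UnitAddCircle))
    fun i => (x i : UnitAddCircle)).comp (measurePreserving_pi_coe d 0)
  rw [← hsub.measure_preimage hm.nullMeasurableSet, ← volume_restrict_cube_eq]
  refine measure_congr ?_
  filter_upwards [ae_restrict_mem measurableSet_Icc] with y hy
  exact propext (by
    change torusDist x y ≤ r ↔ torusNorm _ ≤ r
    rw [torusDist_eq_torusNorm hx hy]
    rfl)

theorem ballVolume_pos (d : ℕ) : 0 < ballVolume d :=
  ENNReal.toReal_pos (Metric.measure_ball_pos _ _ one_pos).ne' measure_ball_lt_top.ne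

/-- The torus ball of radius `1/4` lies in a cube of side `1/2`. The bound keeps the bases `1 + p
(exp l - 1)` positive for negative `l`, and `1 - q` away from `0`. -/
theorem ballVolume_mul_pow_le (d : ℕ) (hd : 1 ≤ d) {r : ℝ} (hr : 0 ≤ r) (hr4 : r < 1 / 4) :
    ballVolume d * r ^ d ≤ 1 / 2 := by
  have h := volume_torusNorm_le d (r := 1 / 4) (by norm_num) (by norm_num)
  have hu : volume {c : Fin d → UnitAddCircle | torusNorm c ≤ 1 / 4} ≤
      volume (Set.pi Set.univ fun _ : Fin d => Metric.closedBall (0 : UnitAddCircle) (1 / 4)) := by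
    refine measure_mono fun c hc i _ => ?_
    rw [mem_closedBall_zero_iff]
    refine le_trans (Real.le_sqrt_of_sq_le ?_) hc
    exact Finset.single_le_sum (f := fun i => ‖c i‖ ^ 2) (fun _ _ => by positivity)
      (Finset.mem_univ i)
  rw [h, volume_pi_pi] at hu
  simp only [AddCircle.volume_closedBall, Finset.prod_const, Finset.card_univ,
    Fintype.card_fin] at hu
  rw [← ENNReal.ofReal_pow (by norm_num), ENNReal.ofReal_le_ofReal_iff (by norm_num)] at hu
  calc ballVolume d * r ^ d ≤ ballVolume d * (1 / 4) ^ d := by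
        have := ballVolume_pos d
        gcongr
    _ ≤ (min 1 (2 * (1 / 4))) ^ d := hu
    _ ≤ (1 / 2) ^ d := by
      apply pow_le_pow_left₀ (by norm_num)
      norm_num
    _ ≤ (1 / 2) ^ 1 := pow_le_pow_of_le_one (by norm_num) (by norm_num) hd
    _ = 1 / 2 := by norm_num

/-! ### Exponential moments of the number of neighbours -/

open Classical in
/-- The number of points of index in `J` within distance `r` of the point `x i`. -/
noncomputable def nbrCount {d m : ℕ} (r : ℝ) (x : Fin m → Fin d → ℝ) (i : Fin m)
    (J : Finset (Fin m)) : ℕ :=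
  (J.filter fun j => torusDist (x i) (x j) ≤ r).card

instance isProbabilityMeasure_cube (d : ℕ) :
    IsProbabilityMeasure ((volume : Measure (Fin d → ℝ)).restrict (Set.Icc 0 1)) :=
  ⟨by
    rw [Measure.restrict_apply_univ, Real.volume_Icc_pi]
    simp⟩

instance isProbabilityMeasure_positionLaw (d m : ℕ) : IsProbabilityMeasure (positionLaw d m) := by
  unfold positionLaw; infer_instance

theorem measurableSet_torusDist_le {Ω : Type*} [MeasurableSpace Ω] {d : ℕ} {f g : Ω → Fin d → ℝ}
    (hf : Measurable f) (hg : Measurable g) (r : ℝ) :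
    MeasurableSet {ω | torusDist (f ω) (g ω) ≤ r} := by
  have hmeas : MeasurableSet {z : (Fin d → ℝ) × (Fin d → ℝ) | torusDist z.1 z.2 ≤ r} :=
    measurableSet_le continuous_torusDist.measurable measurable_const
  exact (hf.prodMk hg) hmeas

open Classical in
-- Given `x i`, the factors are independent with a common mean that does not depend on `x i`. With
-- `c = exp l` this is the moment generating function of a binomial variable.
theorem lintegral_prod_torusDist {d m : ℕ} {r : ℝ} (hr : 0 ≤ r) (hr2 : r < 1 / 2) (c : ℝ≥0∞)
    (i : Fin m) (J : Finset (Fin m)) (hi : i ∉ J) :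
    ∫⁻ x, ∏ j ∈ J, (if torusDist (x i) (x j) ≤ r then c else 1) ∂positionLaw d m =
      (c * ENNReal.ofReal (ballVolume d * r ^ d) +
        (1 - ENNReal.ofReal (ballVolume d * r ^ d))) ^ J.card := by
  obtain _ | m := m
  · exact i.elim0
  set ν : Measure (Fin d → ℝ) := volume.restrict (Set.Icc 0 1) with hν
  have hball : ∀ a ∈ Set.Icc (0 : Fin d → ℝ) 1,
      ∫⁻ y, (if torusDist a y ≤ r then c else 1) ∂ν =
        c * ENNReal.ofReal (ballVolume d * r ^ d) +
          (1 - ENNReal.ofReal (ballVolume d * r ^ d)) := fun a ha => by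
    have hm : MeasurableSet {y | torusDist a y ≤ r} :=
      measurableSet_torusDist_le measurable_const measurable_id r
    have h := volume_torusDist_le ha hr hr2
    have e : ∀ y, (if torusDist a y ≤ r then c else 1) =
        {y | torusDist a y ≤ r}.indicator (fun _ => c) y +
          {y | torusDist a y ≤ r}ᶜ.indicator (fun _ => 1) y := fun y => by
      by_cases hy : torusDist a y ≤ r <;> simp [hy]
    simp_rw [e]
    rw [lintegral_add_left (measurable_const.indicator hm), lintegral_indicator_const hm,
      lintegral_indicator_const hm.compl, prob_compl_eq_one_sub hm, hν, h, one_mul]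
  -- Splitting off coordinate `i` re-indexes the others by `Fin m` through `i.succAbove`; `J'` is
  -- `J` in these coordinates.
  set J' : Finset (Fin m) := Finset.univ.filter fun j => i.succAbove j ∈ J with hJ'
  have hJ : J = J'.map i.succAboveEmb := by
    ext j
    simp only [hJ', Finset.mem_map, Finset.mem_filter, Finset.mem_univ, true_and,
      Fin.coe_succAboveEmb]
    constructor
    · intro hj
      obtain ⟨k, rfl⟩ := Fin.exists_succAbove_eq (x := j) (y := i) fun h => hi (h ▸ hj)
      exact ⟨k, hj, rfl⟩
    · rintro ⟨k, hk, rfl⟩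
      exact hk
  let F : (Fin d → ℝ) × (Fin m → Fin d → ℝ) → ℝ≥0∞ := fun z =>
    ∏ j ∈ J', (if torusDist z.1 (z.2 j) ≤ r then c else 1)
  have hF : Measurable F := Finset.measurable_prod _ fun j _ =>
    Measurable.ite (measurableSet_torusDist_le measurable_fst ((measurable_pi_apply j).comp measurable_snd) r)
      measurable_const measurable_const
  have hcard : J.card = J'.card := by rw [hJ, Finset.card_map]
  have hmp := measurePreserving_piFinSuccAbove (fun _ : Fin (m + 1) => ν) i
  have hcomp : ∀ x : Fin (m + 1) → Fin d → ℝ,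
      ∏ j ∈ J, (if torusDist (x i) (x j) ≤ r then c else 1) =
        F (MeasurableEquiv.piFinSuccAbove (fun _ => Fin d → ℝ) i x) := fun x => by
    rw [hJ, Finset.prod_map]
    rfl
  simp_rw [hcomp]
  rw [positionLaw, hmp.lintegral_comp hF, lintegral_prod _ hF.aemeasurable]
  have hin : ∀ᵐ a ∂ν, ∫⁻ y, F (a, y) ∂(Measure.pi fun _ : Fin m => ν) =
      (c * ENNReal.ofReal (ballVolume d * r ^ d) +
        (1 - ENNReal.ofReal (ballVolume d * r ^ d))) ^ J'.card := by
    filter_upwards [ae_restrict_mem measurableSet_Icc] with a ha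
    have hg : Measurable fun y : Fin d → ℝ => if torusDist a y ≤ r then c else 1 :=
      Measurable.ite (measurableSet_torusDist_le measurable_const measurable_id r)
        measurable_const measurable_const
    have hind := ProbabilityTheory.iIndepFun_pi (μ := fun _ : Fin m => ν)
      (X := fun _ y => if torusDist a y ≤ r then c else 1) fun _ => hg.aemeasurable
    have := ProbabilityTheory.lintegral_prod_eq_prod_lintegral_of_indepFun J' _ hind
      fun j => hg.comp (measurable_pi_apply j)
    refine this.trans ?_
    rw [← Finset.prod_const]
    refine Finset.prod_congr rfl fun j _ => ?_
    rw [← hball a ha]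
    exact (measurePreserving_eval (fun _ : Fin m => ν) j).lintegral_comp hg
  rw [lintegral_congr_ae hin, lintegral_const, measure_univ, mul_one, hcard]

theorem measurable_nbrCount {d m : ℕ} (r : ℝ) (i : Fin m) (J : Finset (Fin m)) :
    Measurable fun x : Fin m → Fin d → ℝ => nbrCount r x i J := by
  classical
  simp_rw [nbrCount, Finset.card_filter]
  exact Finset.measurable_sum _ fun j _ => Measurable.ite (measurableSet_torusDist_le
      (measurable_pi_apply i) (measurable_pi_apply j) r) measurable_const measurable_const

/-- The Chernoff bound for both tails of the number of neighbours of a vertex. -/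
theorem positionLaw_nbrCount_le {d m : ℕ} (hd : 1 ≤ d) {r : ℝ} (hr : 0 ≤ r) (hr4 : r < 1 / 4)
    (l a : ℝ) (i : Fin m) (J : Finset (Fin m)) (hi : i ∉ J) :
    positionLaw d m {x | l * a ≤ l * nbrCount r x i J} ≤
      ENNReal.ofReal (Real.exp (-(l * a)) *
        (1 + ballVolume d * r ^ d * (Real.exp l - 1)) ^ J.card) := by
  classical
  have hp := ballVolume_mul_pow_le d hd hr hr4
  have hp0 : 0 ≤ ballVolume d * r ^ d := by have := ballVolume_pos d; positivity
  set p := ballVolume d * r ^ d with hpdef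
  have hI := lintegral_prod_torusDist (d := d) hr (by linarith : r < 1 / 2)
    (ENNReal.ofReal (Real.exp l)) i J hi
  have hprod : ∀ x : Fin m → Fin d → ℝ,
      ∏ j ∈ J, (if torusDist (x i) (x j) ≤ r then ENNReal.ofReal (Real.exp l) else 1) =
        ENNReal.ofReal (Real.exp (l * nbrCount r x i J)) := fun x => by
    rw [Finset.prod_ite, Finset.prod_const, Finset.prod_const_one, mul_one,
      ← ENNReal.ofReal_pow (Real.exp_pos l).le, ← Real.exp_nat_mul, mul_comm l]
    rfl
  simp_rw [hprod] at hI
  have hM := meas_ge_le_lintegral_div (μ := positionLaw d m)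
    (f := fun x => ENNReal.ofReal (Real.exp (l * nbrCount r x i J)))
    (ε := ENNReal.ofReal (Real.exp (l * a)))
    (by
      have := measurable_nbrCount (d := d) r i J
      refine Measurable.aemeasurable ?_
      refine ENNReal.measurable_ofReal.comp (Real.measurable_exp.comp (Measurable.const_mul ?_ l))
      exact measurable_from_nat.comp this)
    (by simp [Real.exp_pos]) ENNReal.ofReal_ne_top
  have hset : {x : Fin m → Fin d → ℝ | l * a ≤ l * nbrCount r x i J} =
      {x | ENNReal.ofReal (Real.exp (l * a)) ≤
        ENNReal.ofReal (Real.exp (l * nbrCount r x i J))} := by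
    ext x
    simp only [Set.mem_ofPred_eq]
    rw [ENNReal.ofReal_le_ofReal_iff (Real.exp_pos _).le, Real.exp_le_exp]
  rw [hset]
  refine hM.trans ?_
  have he := Real.exp_pos l
  rw [hI, ← ENNReal.ofReal_one, ← ENNReal.ofReal_sub _ hp0, ← ENNReal.ofReal_mul he.le,
    ← ENNReal.ofReal_add (by positivity) (by linarith),
    ← ENNReal.ofReal_pow (by nlinarith), ← ENNReal.ofReal_div_of_pos (Real.exp_pos _)]
  refine ENNReal.ofReal_le_ofReal (le_of_eq ?_)
  rw [Real.exp_neg]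
  have : Real.exp l * p + (1 - p) = 1 + p * (Real.exp l - 1) := by ring
  rw [this]
  field_simp

theorem positionLaw_exists_nbrCount_le {d m : ℕ} (hd : 1 ≤ d) {r : ℝ} (hr : 0 ≤ r) (hr4 : r < 1 / 4)
    (l a : ℝ) (I : Finset (Fin m)) (J : Fin m → Finset (Fin m)) (q : ℕ)
    (hi : ∀ i ∈ I, i ∉ J i ∧ (J i).card = q) :
    positionLaw d m {x | ∃ i ∈ I, l * a ≤ l * nbrCount r x i (J i)} ≤
      ENNReal.ofReal (I.card * (Real.exp (-(l * a)) *
        (1 + ballVolume d * r ^ d * (Real.exp l - 1)) ^ q)) := by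
  have hset : {x : Fin m → Fin d → ℝ | ∃ i ∈ I, l * a ≤ l * nbrCount r x i (J i)} =
      ⋃ i ∈ I, {x | l * a ≤ l * nbrCount r x i (J i)} := by
    ext x; simp
  rw [hset, ENNReal.ofReal_mul (Nat.cast_nonneg _), ENNReal.ofReal_natCast, ← nsmul_eq_mul]
  refine (measure_biUnion_finset_le _ _).trans (Finset.sum_le_card_nsmul _ _ _ fun i h => ?_)
  rw [← (hi i h).2]
  exact positionLaw_nbrCount_le hd hr hr4 l a i (J i) (hi i h).1

/-! ### Failure of the vertex-degree algorithm -/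

theorem deg_plantClique_of_notMem {d m : ℕ} {r : ℝ} (x : Fin m → Fin d → ℝ) {K : Finset (Fin m)}
    {j : Fin m} (hj : j ∉ K) :
    deg (plantClique (geomGraph r x) K) j = nbrCount r x j (Finset.univ.erase j) := by
  classical
  rw [deg, nbrCount, ← Set.ncard_coe_finset]
  congr 1
  ext i
  simp only [SimpleGraph.mem_neighborSet, plantClique, geomGraph, Finset.coe_filter,
    Finset.mem_erase, Finset.mem_univ, Set.mem_ofPred_eq]
  tauto

theorem card_sub_one_add_nbrCount_le_deg {d m : ℕ} {r : ℝ} (x : Fin m → Fin d → ℝ)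
    {K : Finset (Fin m)} {i : Fin m} (hi : i ∈ K) :
    (K.card : ℝ) - 1 + nbrCount r x i Kᶜ ≤ deg (plantClique (geomGraph r x) K) i := by
  classical
  set A := Kᶜ.filter fun j => torusDist (x i) (x j) ≤ r with hA
  have hd : Disjoint (K.erase i) A := by
    rw [Finset.disjoint_left]
    intro j hj hj'
    exact (Finset.mem_compl.1 (Finset.mem_filter.1 hj').1) (Finset.mem_of_mem_erase hj)
  have hsub : (↑(K.erase i ∪ A) : Set (Fin m)) ⊆
      (plantClique (geomGraph r x) K).neighborSet i := by
    intro j hj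
    simp only [hA, Finset.coe_union, Set.mem_union, Finset.mem_coe, Finset.mem_erase,
      Finset.mem_filter, Finset.mem_compl] at hj
    rcases hj with ⟨h1, h2⟩ | ⟨h1, h2⟩
    · exact Or.inr ⟨h1.symm, hi, h2⟩
    · exact Or.inl ⟨fun h => h1 (h ▸ hi), h2⟩
  have h := Set.ncard_le_ncard hsub (Set.toFinite _)
  rw [Set.ncard_coe_finset, Finset.card_union_of_disjoint hd] at h
  have hc := Finset.card_erase_add_one hi
  have hn : nbrCount r x i Kᶜ = A.card := rfl
  rw [hn, ← hc, deg]
  push_cast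
  rw [add_sub_cancel_right]
  exact_mod_cast h

/-- If every vertex of `K` had strictly larger degree than every other vertex, `K` would be the only
possible output: another set of the same size omits some vertex of `K` and contains one from
outside. -/
theorem exists_of_notMem_recoveryEvent {d m k : ℕ} {r : ℝ} {x : Fin m → Fin d → ℝ}
    {K : Finset (Fin m)} (hK : K.card = k)
    (h : (⟨m, x, K⟩ : Outcome d) ∉ recoveryEvent d r k) :
    ∃ i ∈ K, ∃ j ∉ K,
      (k : ℝ) - 1 + nbrCount r x i Kᶜ ≤ nbrCount r x j (Finset.univ.erase j) := by
  by_contra! hc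
  refine h fun S => ?_
  have hlt : ∀ i ∈ K, ∀ j ∉ K, deg (plantClique (geomGraph r x) K) j <
      deg (plantClique (geomGraph r x) K) i := fun i hi j hj => by
    have h1 := hc i hi j hj
    have h2 := card_sub_one_add_nbrCount_le_deg (r := r) x hi
    rw [← deg_plantClique_of_notMem x hj] at h1
    rw [hK] at h2
    exact_mod_cast h1.trans_le h2
  change IsVDOutput (plantClique (geomGraph r x) K) k S ↔ S = K
  constructor
  · rintro ⟨hS, hmax⟩
    by_contra hne
    have h1 : ¬ S ⊆ K := fun hs => hne (Finset.eq_of_subset_of_card_le hs (by omega))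
    have h2 : ¬ K ⊆ S := fun hs => hne (Finset.eq_of_subset_of_card_le hs (by omega)).symm
    obtain ⟨j, hjS, hjK⟩ := Finset.not_subset.1 h1
    obtain ⟨i, hiK, hiS⟩ := Finset.not_subset.1 h2
    exact absurd (hmax j hjS i hiS) (not_le.2 (hlt i hiK j hjK))
  · intro hS
    rw [hS]
    exact ⟨hK, fun i hi j hj => (hlt i hi j hj).le⟩

/-! ### The planted law -/

/-- The uniform distribution on the sets of `k` among `m` vertices. -/
noncomputable abbrev cliqueLaw (m k : ℕ) : Measure (Finset (Fin m)) :=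
  ProbabilityTheory.uniformOn
    (↑(Finset.powersetCard k (Finset.univ : Finset (Fin m))) : Set (Finset (Fin m)))

theorem cliqueLaw_of_lt {m k : ℕ} (h : m < k) : cliqueLaw m k = 0 := by
  rw [cliqueLaw, Finset.powersetCard_eq_empty.2 (by simpa using h), Finset.coe_empty,
    ProbabilityTheory.uniformOn_empty_meas]

theorem isProbabilityMeasure_cliqueLaw {m k : ℕ} (h : k ≤ m) :
    IsProbabilityMeasure (cliqueLaw m k) :=
  ProbabilityTheory.isProbabilityMeasure_uniformOn (Finset.finite_toSet _)
    (Finset.coe_nonempty.2 (Finset.powersetCard_nonempty.2 (by simpa using h)))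

theorem cliqueLaw_univ (m k : ℕ) : cliqueLaw m k Set.univ = if k ≤ m then 1 else 0 := by
  split_ifs with h
  · have := isProbabilityMeasure_cliqueLaw h
    exact measure_univ
  · simp [cliqueLaw_of_lt (not_le.1 h)]

theorem cliqueLaw_card_ne (m k : ℕ) : cliqueLaw m k {K | K.card ≠ k} = 0 := by
  rw [ProbabilityTheory.uniformOn_eq_zero_iff (Finset.finite_toSet _)]
  ext K
  simp [Finset.mem_powersetCard]

instance sFinite_cliqueLaw (m k : ℕ) : SFinite (cliqueLaw m k) := by
  rcases le_or_gt k m with h | h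
  · have := isProbabilityMeasure_cliqueLaw h
    infer_instance
  · rw [cliqueLaw_of_lt h]
    infer_instance

theorem measurable_sigmaMk {d : ℕ} (m : ℕ) : Measurable
    fun z : (Fin m → Fin d → ℝ) × Finset (Fin m) => (⟨m, z⟩ : Outcome d) :=
  fun _ hs => (MeasurableSpace.measurableSet_iInf.1 hs) m

/-- Valid for arbitrary `S`: a measurable hull is taken in each fibre, so measurability of the
recovery event is never needed. -/
theorem plantedLaw_apply_le {d n k : ℕ} (S : Set (Outcome d)) :
    plantedLaw d n k S ≤ ∑' m : ℕ, ProbabilityTheory.poissonMeasure (n : ℝ≥0) {m} *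
      (positionLaw d m).prod (cliqueLaw m k) {z | (⟨m, z⟩ : Outcome d) ∈ S} := by
  set M : ∀ m, Measure ((Fin m → Fin d → ℝ) × Finset (Fin m)) :=
    fun m => (positionLaw d m).prod (cliqueLaw m k) with hM
  set T : Set (Outcome d) := {ω | ω.2 ∈ toMeasurable (M ω.1) {z | (⟨ω.1, z⟩ : Outcome d) ∈ S}} with hT
  have hTm : ∀ m, (fun z => (⟨m, z⟩ : Outcome d)) ⁻¹' T = toMeasurable (M m) {z | (⟨m, z⟩ : Outcome d) ∈ S} := fun m => rfl
  have hTmeas : MeasurableSet T := MeasurableSpace.measurableSet_iInf.2 fun m => by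
    change MeasurableSet ((fun z => (⟨m, z⟩ : Outcome d)) ⁻¹' T)
    rw [hTm]
    exact measurableSet_toMeasurable _ _
  have hST : S ⊆ T := fun ω hω => subset_toMeasurable (M ω.1) {z | (⟨ω.1, z⟩ : Outcome d) ∈ S} hω
  refine (measure_mono hST).trans ?_
  rw [plantedLaw, Measure.sum_apply _ hTmeas]
  refine ENNReal.tsum_le_tsum fun m => ?_
  rw [Measure.smul_apply, Measure.map_apply (measurable_sigmaMk m) hTmeas, smul_eq_mul]
  exact le_of_eq (congrArg _ ((congrArg (M m) (hTm m)).trans (measure_toMeasurable _)))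

theorem plantedLaw_univ (d n k : ℕ) : plantedLaw d n k Set.univ =
    ProbabilityTheory.poissonMeasure (n : ℝ≥0) {m | k ≤ m} := by
  rw [plantedLaw, Measure.sum_apply _ MeasurableSet.univ,
    ← Measure.tsum_indicator_apply_singleton _ _ (MeasurableSet.of_discrete)]
  refine tsum_congr fun m => ?_
  rw [Measure.smul_apply, Measure.map_apply (measurable_sigmaMk m) MeasurableSet.univ,
    Set.preimage_univ, ← Set.univ_prod_univ, Measure.prod_prod, smul_eq_mul, measure_univ, one_mul,
    show ProbabilityTheory.uniformOn _ = cliqueLaw m k from rfl, cliqueLaw_univ,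
    Set.indicator_apply]
  split_ifs with h1 h2 h2
  · simp
  · exact absurd h1 h2
  · exact absurd h2 h1
  · simp

/-- A union bound for the positions conditionally on the planted set. -/
theorem prod_cliqueLaw_le {d m k : ℕ} (S : Set ((Fin m → Fin d → ℝ) × Finset (Fin m)))
    (A : Set (Fin m → Fin d → ℝ)) (B : Finset (Fin m) → Set (Fin m → Fin d → ℝ))
    (hS : ∀ z ∈ S, z.2.card = k → z.1 ∈ A ∨ z.1 ∈ B z.2) (b : ℝ≥0∞)
    (hb : ∀ K, K.card = k → positionLaw d m (B K) ≤ b) :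
    (positionLaw d m).prod (cliqueLaw m k) S ≤
      positionLaw d m A + if k ≤ m then b else 0 := by
  have hsub : S ⊆ A ×ˢ Set.univ ∪
      ((⋃ K ∈ Finset.powersetCard k (Finset.univ : Finset (Fin m)), B K ×ˢ {K}) ∪
        Set.univ ×ˢ {K | K.card ≠ k}) := fun z hz => by
    by_cases h : z.2.card = k
    · rcases hS z hz h with h' | h'
      · exact Or.inl ⟨h', trivial⟩
      · refine Or.inr (Or.inl (Set.mem_biUnion (x := z.2) ?_ ⟨h', rfl⟩))
        simp [Finset.mem_powersetCard, h]
    · exact Or.inr (Or.inr ⟨trivial, h⟩)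
  refine (measure_mono hsub).trans ((measure_union_le _ _).trans (add_le_add ?_
    ((measure_union_le _ _).trans ?_)))
  · rw [Measure.prod_prod, cliqueLaw_univ]
    split_ifs <;> simp
  · rw [Measure.prod_prod, cliqueLaw_card_ne, mul_zero, add_zero]
    refine (measure_biUnion_finset_le _ _).trans ?_
    calc ∑ K ∈ Finset.powersetCard k (Finset.univ : Finset (Fin m)),
          (positionLaw d m).prod (cliqueLaw m k) (B K ×ˢ {K})
        ≤ ∑ K ∈ Finset.powersetCard k (Finset.univ : Finset (Fin m)), b * cliqueLaw m k {K} := by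
          refine Finset.sum_le_sum fun K hK => ?_
          rw [Measure.prod_prod]
          gcongr
          exact hb K (Finset.mem_powersetCard.1 hK).2
      _ = b * cliqueLaw m k (Finset.powersetCard k (Finset.univ : Finset (Fin m))) := by
          rw [← Finset.mul_sum, sum_measure_singleton]
      _ ≤ b * cliqueLaw m k Set.univ := by
          gcongr
          exact Set.subset_univ _
      _ = if k ≤ m then b else 0 := by
          rw [cliqueLaw_univ]
          split_ifs <;> simp

/-! ### Poisson sums -/

/-- The factor `m` cancels against `m!` and shifts the exponential series by one, which matches the
power `m - 1`: a vertex has `m - 1` potential neighbours. -/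
theorem tsum_poisson_mul_card {n : ℕ} {C y : ℝ} (hC : 0 ≤ C) (hy : 0 ≤ y) :
    ∑' m : ℕ, ProbabilityTheory.poissonMeasure (n : ℝ≥0) {m} *
      ENNReal.ofReal (m * (C * y ^ (m - 1))) =
      ENNReal.ofReal (n * (C * Real.exp (n * (y - 1)))) := by
  have hs : HasSum (fun m : ℕ => Real.exp (-n) * n ^ m / m.factorial * (m * (C * y ^ (m - 1))))
      (n * (C * Real.exp (n * (y - 1)))) := by
    rw [← hasSum_nat_add_iff' 1]
    have h := (NormedSpace.expSeries_div_hasSum_exp ((n : ℝ) * y)).mul_left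
      (n * C * Real.exp (-n))
    rw [← Real.exp_eq_exp_ℝ] at h
    convert! h using 1
    · funext m
      rw [Nat.factorial_succ, mul_pow, pow_succ]
      push_cast
      have : (m : ℝ) + 1 ≠ 0 := by positivity
      have : (m.factorial : ℝ) ≠ 0 := by positivity
      field_simp
    · have : Real.exp (n * (y - 1)) = Real.exp (-n) * Real.exp (n * y) := by
        rw [← Real.exp_add]; congr 1; ring
      rw [this]
      simp
      ring
  rw [← hs.tsum_eq, ENNReal.ofReal_tsum_of_nonneg (fun m => by positivity) hs.summable]
  refine tsum_congr fun m => ?_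
  rw [ProbabilityTheory.poissonMeasure_singleton, ← ENNReal.ofReal_mul (by positivity)]
  simp

/-- Write `y ^ (m - k) = y⁻¹ ^ k * y ^ m` for `k ≤ m` and extend the sum to all `m`. -/
theorem tsum_poisson_mul_pow_le {n k : ℕ} {C y : ℝ} (hC : 0 ≤ C) (hy : 0 < y) :
    ∑' m : ℕ, ProbabilityTheory.poissonMeasure (n : ℝ≥0) {m} *
      (if k ≤ m then ENNReal.ofReal (C * y ^ (m - k)) else 0) ≤
      ENNReal.ofReal (C * (y⁻¹ ^ k * Real.exp (n * (y - 1)))) := by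
  have hs : HasSum (fun m : ℕ => Real.exp (-n) * n ^ m / m.factorial * (C * (y⁻¹ ^ k * y ^ m)))
      (C * (y⁻¹ ^ k * Real.exp (n * (y - 1)))) := by
    have h := (NormedSpace.expSeries_div_hasSum_exp ((n : ℝ) * y)).mul_left
      (C * y⁻¹ ^ k * Real.exp (-n))
    rw [← Real.exp_eq_exp_ℝ] at h
    convert! h using 1
    · funext m
      rw [mul_pow]
      ring
    · have : Real.exp (n * (y - 1)) = Real.exp (-n) * Real.exp (n * y) := by
        rw [← Real.exp_add]; congr 1; ring
      rw [this]
      ring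
  rw [← hs.tsum_eq, ENNReal.ofReal_tsum_of_nonneg (fun m => by positivity) hs.summable]
  refine ENNReal.tsum_le_tsum fun m => ?_
  split_ifs with h
  · rw [ProbabilityTheory.poissonMeasure_singleton, ← ENNReal.ofReal_mul (by positivity)]
    refine ENNReal.ofReal_le_ofReal (le_of_eq ?_)
    rw [inv_pow, pow_sub₀ _ hy.ne' h, mul_comm (y ^ m)]
    simp
  · simp

/-! ### Upper bounds for the probability of failure -/

/-- Outside the exceptional sets `B m K`, failure forces a vertex with at least `s` neighbours. The
Chernoff union bound for that event averages to the first term. Taking `B` empty or a lower-tail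
event yields the two estimates used later. -/
theorem plantedLaw_compl_recoveryEvent_le {d : ℕ} (hd : 1 ≤ d) {r : ℝ} (hr : 0 ≤ r) (hr4 : r < 1 / 4)
    {n k : ℕ} (hn : 1 ≤ n) {s l : ℝ} (hl : 0 ≤ l)
    (B : ∀ m, Finset (Fin m) → Set (Fin m → Fin d → ℝ)) (b : ℕ → ℝ≥0∞)
    (hb : ∀ m K, K.card = k → positionLaw d m (B m K) ≤ b m)
    (hB : ∀ m K x, K.card = k → x ∉ B m K → ∀ i ∈ K, s ≤ k - 1 + nbrCount r x i Kᶜ) :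
    plantedLaw d n k (recoveryEvent d r k)ᶜ ≤
      ENNReal.ofReal (Real.exp (Real.log n + n * (ballVolume d * r ^ d) * (Real.exp l - 1) - l * s)) +
        ∑' m : ℕ, ProbabilityTheory.poissonMeasure (n : ℝ≥0) {m} * (if k ≤ m then b m else 0) := by
  have hp := ballVolume_mul_pow_le d hd hr hr4
  have hp0 : 0 ≤ ballVolume d * r ^ d := by have := ballVolume_pos d; positivity
  have hn0 : (0 : ℝ) < n := by exact_mod_cast hn
  set p := ballVolume d * r ^ d with hpdef
  set y := 1 + p * (Real.exp l - 1) with hy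
  have hy0 : 0 ≤ y := by
    have := Real.one_le_exp hl
    have : 0 ≤ p * (Real.exp l - 1) := mul_nonneg hp0 (by linarith)
    linarith
  refine (plantedLaw_apply_le _).trans ?_
  have hfirst : ∑' m : ℕ, ProbabilityTheory.poissonMeasure (n : ℝ≥0) {m} *
      ENNReal.ofReal (m * (Real.exp (-(l * s)) * y ^ (m - 1))) =
      ENNReal.ofReal (Real.exp (Real.log n + n * p * (Real.exp l - 1) - l * s)) := by
    rw [tsum_poisson_mul_card (Real.exp_pos _).le hy0]
    congr 1
    rw [Real.exp_sub, Real.exp_add, Real.exp_log hn0, Real.exp_neg, hy, add_sub_cancel_left,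
      mul_assoc (n : ℝ) p]
    ring
  rw [← hfirst, ← ENNReal.tsum_add]
  refine ENNReal.tsum_le_tsum fun m => ?_
  rw [← mul_add]
  gcongr
  refine (prod_cliqueLaw_le _ {x | ∃ i ∈ Finset.univ,
    l * s ≤ l * nbrCount r x i (Finset.univ.erase i)} (B m) ?_ (b m) (hb m)).trans ?_
  · rintro ⟨x, K⟩ hz hK
    obtain ⟨i, hi, j, hj, hij⟩ := exists_of_notMem_recoveryEvent hK hz
    by_cases hx : x ∈ B m K
    · exact Or.inr hx
    · exact Or.inl ⟨j, Finset.mem_univ _,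
        mul_le_mul_of_nonneg_left ((hB m K x hK hx i hi).trans hij) hl⟩
  · gcongr
    refine (positionLaw_exists_nbrCount_le hd hr hr4 l s Finset.univ _ (m - 1) fun i _ =>
      ⟨Finset.notMem_erase _ _, ?_⟩).trans_eq ?_
    · rw [Finset.card_erase_of_mem (Finset.mem_univ _), Finset.card_univ, Fintype.card_fin]
    · rw [Finset.card_univ, Fintype.card_fin]

/-- Failure is unlikely when no vertex has `k - 1` neighbours in the geometric graph. -/
theorem plantedLaw_failure_le_of_le {d : ℕ} (hd : 1 ≤ d) {r : ℝ} (hr : 0 ≤ r) (hr4 : r < 1 / 4)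
    {n k : ℕ} (hn : 1 ≤ n) {s l : ℝ} (hl : 0 ≤ l) (hs : s ≤ k - 1) :
    plantedLaw d n k (recoveryEvent d r k)ᶜ ≤
      ENNReal.ofReal (Real.exp
        (Real.log n + n * (ballVolume d * r ^ d) * (Real.exp l - 1) - l * s)) := by
  have h := plantedLaw_compl_recoveryEvent_le hd hr hr4 (k := k) (s := s) hn hl (fun _ _ => ∅)
    (fun _ => 0) (fun m K _ => by simp) (fun m K x _ _ i _ =>
      hs.trans (le_add_of_nonneg_right (Nat.cast_nonneg _)))
  simpa using h

/-- Failure is unlikely when the vertices have less than `s` neighbours and those of the planted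
set more than `u` outer neighbours. -/
theorem plantedLaw_failure_le {d : ℕ} (hd : 1 ≤ d) {r : ℝ} (hr : 0 ≤ r) (hr4 : r < 1 / 4)
    {n k : ℕ} (hn : 1 ≤ n) (hkn : k ≤ n) {s l θ u q : ℝ} (hl : 0 ≤ l) (hθ : 0 ≤ θ)
    (hs : s ≤ k - 1 + u) (hq : q = ballVolume d * r ^ d * (1 - Real.exp (-θ))) :
    plantedLaw d n k (recoveryEvent d r k)ᶜ ≤
      ENNReal.ofReal (Real.exp
        (Real.log n + n * (ballVolume d * r ^ d) * (Real.exp l - 1) - l * s)) +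
      ENNReal.ofReal (Real.exp (Real.log n + k * (q / (1 - q)) -
        n * (ballVolume d * r ^ d) * (1 - Real.exp (-θ)) + θ * u)) := by
  have hp := ballVolume_mul_pow_le d hd hr hr4
  have hp0 : 0 ≤ ballVolume d * r ^ d := by have := ballVolume_pos d; positivity
  have hn0 : (0 : ℝ) < n := by exact_mod_cast hn
  set p := ballVolume d * r ^ d with hpdef
  have he1 : Real.exp (-θ) ≤ 1 := Real.exp_le_one_iff.2 (by linarith)
  have he0 := Real.exp_pos (-θ)
  have hq0 : 0 ≤ q := hq ▸ mul_nonneg hp0 (by linarith)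
  have hq1 : q ≤ 1 / 2 := by rw [hq]; nlinarith
  have hy : 1 + p * (Real.exp (-θ) - 1) = 1 - q := by rw [hq]; ring
  have h := plantedLaw_compl_recoveryEvent_le hd hr hr4 (k := k) (s := s) hn hl
    (fun m K => {x | ∃ i ∈ K, -θ * u ≤ -θ * nbrCount r x i Kᶜ})
    (fun m => ENNReal.ofReal (k * (Real.exp (-(-θ * u)) * (1 - q) ^ (m - k))))
    (fun m K hK => by
      have := positionLaw_exists_nbrCount_le (d := d) hd hr hr4 (-θ) u K (fun _ => Kᶜ) (m - k)
        fun i hi => ⟨fun h => Finset.mem_compl.1 h hi, by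
          rw [Finset.card_compl, Fintype.card_fin, hK]⟩
      rwa [hK, ← hpdef, hy] at this)
    (fun m K x hK hx i hi => by
      simp only [Set.mem_ofPred_eq, not_exists, not_and, not_le] at hx
      have := hx i hi
      have hu : u ≤ nbrCount r x i Kᶜ := by
        by_contra! hlt
        nlinarith
      linarith)
  refine h.trans ?_
  gcongr
  have h2 := tsum_poisson_mul_pow_le (n := n) (k := k) (C := k * Real.exp (-(-θ * u)))
    (y := 1 - q) (by positivity) (by linarith)
  simp_rw [← mul_assoc (k : ℝ)]
  refine h2.trans (ENNReal.ofReal_le_ofReal ?_)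
  -- The loss from removing the `k` planted vertices from the count, put into exponential form via
  -- `(1 - q)⁻¹ = 1 + q / (1 - q)`.
  have hexp : (1 - q)⁻¹ ^ k ≤ Real.exp (k * (q / (1 - q))) := by
    rw [Real.exp_nat_mul]
    have hpos : 0 < 1 - q := by linarith
    refine pow_le_pow_left₀ (by positivity) ?_ k
    have e : (1 - q)⁻¹ = q / (1 - q) + 1 := by field_simp; ring
    rw [e]
    exact Real.add_one_le_exp _
  have hkn' : (k : ℝ) ≤ n := by exact_mod_cast hkn
  have e : Real.exp (Real.log n + k * (q / (1 - q)) - n * p * (1 - Real.exp (-θ)) + θ * u) =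
      n * Real.exp (-(-θ * u)) * (Real.exp (k * (q / (1 - q))) * Real.exp (n * (1 - q - 1))) := by
    rw [show Real.log n + k * (q / (1 - q)) - n * p * (1 - Real.exp (-θ)) + θ * u =
      Real.log n + -(-θ * u) + (k * (q / (1 - q)) + n * (1 - q - 1)) by rw [hq]; ring,
      Real.exp_add, Real.exp_add, Real.exp_add, Real.exp_log hn0]
  rw [e]
  have hpos : 0 ≤ (1 - q)⁻¹ := by rw [inv_nonneg]; linarith
  -- The union bound over `K` gives a factor `k`, here replaced by `n` to produce the term `log n`.
  gcongr

/-- The law has total mass `P(N ≥ k)`, which tends to `1` by `Plantable`; subadditivity bounds the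
recovery probability below by this mass minus the failure bound. -/
theorem vdRecovers_of_failure_le {d : ℕ} {r : ℕ → ℝ} {k : ℕ → ℕ} (hplant : Plantable k)
    {E F : ℕ → ℝ} (hE : Tendsto E atTop atBot) (hF : Tendsto F atTop atBot)
    (h : ∀ᶠ n in atTop, plantedLaw d n (k n) (recoveryEvent d (r n) (k n))ᶜ ≤
      ENNReal.ofReal (Real.exp (E n)) + ENNReal.ofReal (Real.exp (F n))) :
    VDRecovers d r k := by
  have hlim : ∀ {E : ℕ → ℝ}, Tendsto E atTop atBot →
      Tendsto (fun n => ENNReal.ofReal (Real.exp (E n))) atTop (𝓝 0) := fun hE => by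
    have := ENNReal.tendsto_ofReal (Real.tendsto_exp_atBot.comp hE)
    simpa using this
  have h0 := (hlim hE).add (hlim hF)
  rw [add_zero] at h0
  have hsub := ENNReal.Tendsto.sub hplant h0 (Or.inl ENNReal.one_ne_top)
  rw [tsub_zero] at hsub
  refine tendsto_of_tendsto_of_tendsto_of_le_of_le' hsub tendsto_const_nhds ?_
    (Eventually.of_forall fun n => ?_)
  · filter_upwards [h] with n hn
    rw [tsub_le_iff_right, ← plantedLaw_univ d]
    refine le_trans ?_ (add_le_add le_rfl hn)
    rw [← Set.union_compl_self (recoveryEvent d (r n) (k n))]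
    exact measure_union_le _ _
  · refine (measure_mono (Set.subset_univ _)).trans ?_
    rw [plantedLaw_univ]
    exact prob_le_one

/-! ### Asymptotics -/

theorem meanDegree_nonneg (d : ℕ) {r : ℕ → ℝ} (hr : ∀ n, 0 < r n) (n : ℕ) :
    0 ≤ meanDegree d r n := by
  have := ballVolume_pos d
  have := hr n
  unfold meanDegree
  positivity

theorem meanDegree_pos (d : ℕ) {r : ℕ → ℝ} (hr : ∀ n, 0 < r n) {n : ℕ} (hn : 1 ≤ n) :
    0 < meanDegree d r n := by
  have := ballVolume_pos d
  have := hr n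
  have : (0 : ℝ) < n := by exact_mod_cast hn
  unfold meanDegree
  positivity

theorem tendsto_log_natCast : Tendsto (fun n : ℕ => Real.log n) atTop atTop :=
  Real.tendsto_log_atTop.comp tendsto_natCast_atTop_atTop

theorem tendsto_log_sub_mul_atBot {μ : ℕ → ℝ} {h : ℝ}
    (hμ : ∃ c < 0, ∀ᶠ n : ℕ in atTop, 1 - μ n / Real.log n * h ≤ c) :
    Tendsto (fun n : ℕ => Real.log n - μ n * h) atTop atBot := by
  obtain ⟨c, hc, hev⟩ := hμ
  refine tendsto_atBot_mono' _ ?_ (tendsto_log_natCast.atTop_mul_const_of_neg hc)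
  filter_upwards [hev, tendsto_log_natCast.eventually_gt_atTop 0] with n hn hl
  calc Real.log n - μ n * h = Real.log n * (1 - μ n / Real.log n * h) := by field_simp
    _ ≤ Real.log n * c := by gcongr

theorem tendsto_log_sub_mul_atBot_of_tendsto {μ : ℕ → ℝ} {h α : ℝ}
    (hμ : Tendsto (fun n : ℕ => μ n / Real.log n) atTop (𝓝 α)) (hα : 1 < α * h) :
    Tendsto (fun n : ℕ => Real.log n - μ n * h) atTop atBot := by
  refine tendsto_log_sub_mul_atBot ⟨(1 - α * h) / 2, by linarith, ?_⟩
  have := (hμ.mul_const h).const_sub 1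
  filter_upwards [this.eventually_lt_const (show 1 - α * h < (1 - α * h) / 2 by linarith)]
    with n hn using hn.le

theorem tendsto_log_sub_mul_atBot_of_tendsto_atTop {μ : ℕ → ℝ} {h : ℝ}
    (hμ : Tendsto (fun n : ℕ => μ n / Real.log n) atTop atTop) (hh : 0 < h) :
    Tendsto (fun n : ℕ => Real.log n - μ n * h) atTop atBot := by
  refine tendsto_log_sub_mul_atBot ⟨-1, by norm_num, ?_⟩
  filter_upwards [(hμ.atTop_mul_const hh).eventually_ge_atTop 2] with n hn
  linarith

/-- The Chernoff exponent at threshold `xμ` with its optimal parameter `log x`; `x > 1` serves the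
upper tail and `x < 1` the lower one. -/
theorem entropyH_exponent (x μ l : ℝ) :
    l + μ * (x - 1) - Real.log x * (x * μ) = l - μ * entropyH x := by
  rw [entropyH]; ring

theorem one_sub_exp_neg_ge {θ : ℝ} (hθ : 0 ≤ θ) : θ - θ ^ 2 ≤ 1 - Real.exp (-θ) := by
  have h1 := Real.add_one_le_exp θ
  have h2 : Real.exp (-θ) ≤ (θ + 1)⁻¹ := by
    rw [Real.exp_neg]
    exact inv_anti₀ (by linarith) h1
  have h3 : (θ + 1)⁻¹ ≤ 1 - θ + θ ^ 2 := by
    rw [inv_le_iff_one_le_mul₀ (by linarith)]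
    nlinarith [pow_nonneg hθ 3]
  linarith

/-- Recovery when the average degree is of larger order than `log n`. -/
theorem vdRecovers_of_superlogarithmic {d : ℕ} (hd : 1 ≤ d) {r : ℕ → ℝ}
    (hr : ∀ n, 0 < r n ∧ r n < 1 / 4) {k : ℕ → ℕ} (hplant : Plantable k) {ε : ℝ} (hε : 0 < ε)
    (hμ : Tendsto (fun n : ℕ => meanDegree d r n / Real.log n) atTop atTop)
    (hkε : ∀ᶠ n : ℕ in atTop, ε * meanDegree d r n < k n) : VDRecovers d r k := by
  -- With `δ` this small, `k ≥ 16δμ`, so the gain of order `δk` in the lower-tail exponent beats the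
  -- errors `2δ²μ` and leaves `-2δ²μ`.
  set δ := min ε 1 / 16 with hδ
  have hδ0 : 0 < δ := by positivity
  have hδε : 16 * δ ≤ ε := by rw [hδ]; linarith [min_le_left ε 1]
  have hδ1 : 16 * δ ≤ 1 := by rw [hδ]; linarith [min_le_right ε 1]
  have hH : 0 < entropyH (1 + δ) := by
    have := strictMonoOn_entropyH (Set.self_mem_Ici (a := (1 : ℝ)))
      (show (1 + δ) ∈ Set.Ici (1 : ℝ) by simp [hδ0.le]) (by linarith)
    simpa [entropyH] using this
  have hE := tendsto_log_sub_mul_atBot_of_tendsto_atTop hμ hH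
  have hF := tendsto_atBot_add_const_right _ δ
    (tendsto_log_sub_mul_atBot_of_tendsto_atTop hμ (h := 2 * δ ^ 2) (by positivity))
  refine vdRecovers_of_failure_le hplant hE hF ?_
  filter_upwards [hkε, eventually_ge_atTop 4] with n hk hn
  have hn1 : 1 ≤ n := by omega
  have hn4 : (4 : ℝ) ≤ n := by exact_mod_cast hn
  set μ := meanDegree d r n with hμdef
  have hμ0 : 0 ≤ μ := meanDegree_nonneg d (fun n => (hr n).1) n
  have hp := ballVolume_mul_pow_le d hd (hr n).1.le (hr n).2
  have hp0 : 0 ≤ ballVolume d * r n ^ d := by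
    have := ballVolume_pos d
    have := (hr n).1
    positivity
  set p := ballVolume d * r n ^ d with hpdef
  have hμp : n * p = μ := by rw [hpdef, hμdef, meanDegree, mul_assoc]
  have hl : 0 ≤ Real.log (1 + δ) := Real.log_nonneg (by linarith)
  have hexp : Real.exp (Real.log (1 + δ)) = 1 + δ := Real.exp_log (by linarith)
  -- If `k - 1` exceeds the upper threshold, no outer neighbours are needed. Otherwise `k < (1 + δ)μ
  -- + 1`, and `μ ≤ n/2` yields `k ≤ n`.
  rcases le_or_gt ((1 + δ) * μ) (k n - 1) with hs | hs
  · refine le_add_right ?_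
    have h := plantedLaw_failure_le_of_le hd (hr n).1.le (hr n).2 (k := k n) hn1 hl hs
    rwa [hexp, ← hpdef, hμp, entropyH_exponent] at h
  · have hkn : k n ≤ n := by
      have h1 : μ ≤ n / 2 := by rw [← hμp]; nlinarith
      have : (k n : ℝ) ≤ n := by nlinarith
      exact_mod_cast this
    have h := plantedLaw_failure_le hd (hr n).1.le (hr n).2 (k := k n) hn1 hkn (θ := δ)
      (s := (1 + δ) * μ) (u := (1 + δ) * μ - (k n - 1)) hl hδ0.le (by linarith) rfl
    rw [hexp, ← hpdef, hμp, entropyH_exponent] at h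
    refine h.trans (add_le_add le_rfl (ENNReal.ofReal_le_ofReal (Real.exp_le_exp.2 ?_)))
    have he1 := one_sub_exp_neg_ge hδ0.le
    have he2 : 1 - Real.exp (-δ) ≤ δ := by linarith [Real.one_sub_le_exp_neg δ]
    have he0 : 0 ≤ 1 - Real.exp (-δ) := by nlinarith
    set q := p * (1 - Real.exp (-δ)) with hq
    have hq1 : q ≤ δ / 2 := by nlinarith
    have hqq : q / (1 - q) ≤ δ * (1 + δ) / 2 := by
      rw [div_le_iff₀ (by linarith)]
      nlinarith [mul_nonneg hδ0.le (mul_nonneg hδ0.le hδ0.le)]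
    have hk0 : (0 : ℝ) ≤ k n := Nat.cast_nonneg _
    have t1 : (k n : ℝ) * (q / (1 - q)) ≤ k n * (δ * (1 + δ) / 2) := by gcongr
    have t2 : μ * (δ - δ ^ 2) ≤ μ * (1 - Real.exp (-δ)) := by gcongr
    have t3 : 16 * δ * μ ≤ k n := by nlinarith
    have t4 : 4 * δ * μ ≤ k n * ((1 - δ) / 2) := by nlinarith
    have t5 := mul_le_mul_of_nonneg_left t4 hδ0.le
    linarith

theorem entropyH_one : entropyH 1 = 0 := by simp [entropyH]

theorem one_lt_HinvPlus {y : ℝ} (hy : 0 < y) : 1 < HinvPlus y := by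
  obtain ⟨h1, h2⟩ := HinvPlus_spec hy.le
  refine h1.lt_of_ne fun h => ?_
  rw [← h, entropyH_one] at h2
  exact hy.ne h2

/-- Unifies the cases of the minimum degree. For `α ≤ 1` one has `a = 0`, and then no lower-tail
estimate is required, so the equation for `H` is needed only when `a > 0`. -/
theorem minDegAsymp_eq {α : ℝ} (hα : 0 < α) : ∃ a : ℝ, 0 ≤ a ∧ a < 1 ∧
    (∀ μ, minDegAsymp α μ = μ * a) ∧ (0 < a → entropyH a = α⁻¹) := by
  rcases lt_or_ge α 1 with h | h
  · exact ⟨0, le_rfl, one_pos, fun μ => by simp [minDegAsymp, h], fun h => absurd h (lt_irrefl 0)⟩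
  · have hy : 0 < α⁻¹ := inv_pos.2 hα
    obtain ⟨h1, h2⟩ := HinvMinus_spec hy.le (inv_le_one_of_one_le₀ h)
    refine ⟨HinvMinus α⁻¹, h1.1, h1.2.lt_of_ne fun h' => ?_, fun μ => ?_, fun _ => h2⟩
    · rw [h', entropyH_one] at h2
      exact hy.ne h2
    · rw [minDegAsymp, if_neg (not_lt.2 h)]

/-- Recovery when the average degree is of order `log n`. -/
theorem vdRecovers_of_logarithmic {d : ℕ} (hd : 1 ≤ d) {r : ℕ → ℝ}
    (hr : ∀ n, 0 < r n ∧ r n < 1 / 4) {k : ℕ → ℕ} (hplant : Plantable k) {ε : ℝ} (hε : 0 < ε)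
    {α : ℝ} (hα : 0 < α)
    (hμ : Tendsto (fun n : ℕ => meanDegree d r n / Real.log n) atTop (𝓝 α))
    (hkε : ∀ᶠ n : ℕ in atTop, (1 + ε) * (maxDegAsymp α (meanDegree d r n) n
      - minDegAsymp α (meanDegree d r n)) < k n) : VDRecovers d r k := by
  obtain ⟨a, ha0, ha1, hmin, hHa⟩ := minDegAsymp_eq hα
  set A := HinvPlus α⁻¹ with hA
  have hA1 : 1 < A := one_lt_HinvPlus (inv_pos.2 hα)
  have hHA : entropyH A = α⁻¹ := (HinvPlus_spec (inv_pos.2 hα).le).2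
  have hlogev := tendsto_log_natCast.eventually_gt_atTop 0
  have hμtop : Tendsto (meanDegree d r) atTop atTop := by
    refine (hμ.pos_mul_atTop hα tendsto_log_natCast).congr' ?_
    filter_upwards [hlogev] with n hn
    field_simp
  -- Since `k = O(μ)` in the nontrivial case and `p = μ/n`, the loss `k q / (1 - q)` is `O(μ²/n)`;
  -- it is later bounded by `1`.
  have hsq : Tendsto (fun n : ℕ => meanDegree d r n ^ 2 / n) atTop (𝓝 0) := by
    have h1 := (Real.tendsto_pow_log_div_mul_add_atTop 1 0 2 one_ne_zero).comp
      (tendsto_natCast_atTop_atTop (R := ℝ))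
    have h2 := (hμ.pow 2).mul h1
    rw [mul_zero] at h2
    refine h2.congr' ?_
    filter_upwards [hlogev] with n hn
    simp only [Function.comp_apply, one_mul, add_zero]
    field_simp
  -- Moving both thresholds by a quarter of `ε (A - a)` uses half of the surplus; the other half,
  -- times `μ`, absorbs the `1` in `k - 1`.
  have hgap : 0 < ε * (A - a) / 4 := by
    have : 0 < A - a := by linarith
    positivity
  set A' := A + ε * (A - a) / 4 with hA'
  have hHA' : 1 < α * entropyH A' := by
    have h := strictMonoOn_entropyH (show A ∈ Set.Ici (1 : ℝ) from hA1.le)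
      (show A' ∈ Set.Ici (1 : ℝ) by simp only [Set.mem_Ici]; linarith) (by linarith)
    rw [hHA] at h
    rwa [inv_lt_iff_one_lt_mul₀' hα] at h
  have hE := tendsto_log_sub_mul_atBot_of_tendsto hμ hHA'
  have hl : 0 ≤ Real.log A' := Real.log_nonneg (by linarith)
  have hexp : Real.exp (Real.log A') = A' := Real.exp_log (by linarith)
  have hμp : ∀ n, n * (ballVolume d * r n ^ d) = meanDegree d r n := fun n => by
    rw [meanDegree, mul_assoc]
  have hmax : ∀ n : ℕ, maxDegAsymp α (meanDegree d r n) n = meanDegree d r n * A := fun n => by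
    rw [maxDegAsymp, if_neg hα.ne']
  have htriv : ∀ n : ℕ, 1 ≤ n → A' * meanDegree d r n ≤ k n - 1 →
      plantedLaw d n (k n) (recoveryEvent d (r n) (k n))ᶜ ≤
        ENNReal.ofReal (Real.exp (Real.log n - meanDegree d r n * entropyH A')) :=
    fun n hn hs => by
      have h := plantedLaw_failure_le_of_le hd (hr n).1.le (hr n).2 (k := k n) hn hl hs
      rwa [hexp, hμp, entropyH_exponent] at h
  rcases ha0.eq_or_lt with ha | ha
  · refine vdRecovers_of_failure_le hplant hE hE ?_
    filter_upwards [hkε, eventually_ge_atTop 1,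
      (hμtop.const_mul_atTop hgap).eventually_ge_atTop 1] with n hk hn hμn
    refine le_add_right (htriv n hn ?_)
    rw [hmax, hmin, ← ha] at hk
    rw [← ha] at hμn
    rw [hA', ← ha]
    nlinarith
  · set a' := max (a / 2) (a - ε * (A - a) / 4) with ha'
    have ha'0 : 0 < a' := lt_max_of_lt_left (by linarith)
    have ha'a : a' < a := max_lt (by linarith) (by linarith)
    have ha'g : a - ε * (A - a) / 4 ≤ a' := le_max_right _ _
    have hHa' : 1 < α * entropyH a' := by
      have h := strictAntiOn_entropyH (show a' ∈ Set.Icc (0 : ℝ) 1 from ⟨ha'0.le, by linarith⟩)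
        (show a ∈ Set.Icc (0 : ℝ) 1 from ⟨ha0, ha1.le⟩) ha'a
      rw [hHa ha] at h
      rwa [inv_lt_iff_one_lt_mul₀' hα] at h
    have hF := tendsto_atBot_add_const_right _ 1
      (tendsto_log_sub_mul_atBot_of_tendsto hμ hHa')
    refine vdRecovers_of_failure_le hplant hE hF ?_
    have hB : 0 < (2 * (A' + 1))⁻¹ := inv_pos.2 (by linarith)
    filter_upwards [hkε, eventually_ge_atTop 1, (hμtop.const_mul_atTop hgap).eventually_ge_atTop 1,
      hμtop.eventually_ge_atTop 1, hsq.eventually_lt_const hB] with n hk hn hμn hμ1 hμsq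
    rcases le_or_gt (A' * meanDegree d r n) (k n - 1) with hs | hs
    · exact le_add_right (htriv n hn hs)
    · have hn0 : (0 : ℝ) < n := by exact_mod_cast hn
      rw [hmax, hmin] at hk
      have hp := ballVolume_mul_pow_le d hd (hr n).1.le (hr n).2
      have hp0 : 0 ≤ ballVolume d * r n ^ d := by
        have := ballVolume_pos d
        have := (hr n).1
        positivity
      have hμpn := hμp n
      set μ := meanDegree d r n
      set p := ballVolume d * r n ^ d with hpdef
      have hμsq' : 2 * (A' + 1) * μ ^ 2 ≤ n := by
        rw [div_lt_iff₀ hn0, inv_mul_eq_div, lt_div_iff₀ (by linarith)] at hμsq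
        linarith
      have hkμ : (k n : ℝ) ≤ (A' + 1) * μ := by linarith
      have hAμ : (A' + 1) * μ ≤ (A' + 1) * μ ^ 2 :=
        mul_le_mul_of_nonneg_left (by nlinarith) (by linarith)
      have hkn : k n ≤ n := by
        have h0 : 0 ≤ (A' + 1) * μ ^ 2 := mul_nonneg (by linarith) (sq_nonneg _)
        have : (k n : ℝ) ≤ n := by linarith
        exact_mod_cast this
      have hθ : 0 ≤ -Real.log a' := by
        have := Real.log_nonpos ha'0.le (by linarith)
        linarith
      have hsu : A' * μ ≤ k n - 1 + a' * μ := by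
        have := mul_le_mul_of_nonneg_right ha'g (zero_le_one.trans hμ1)
        rw [hA']
        linarith
      have h := plantedLaw_failure_le hd (hr n).1.le (hr n).2 (k := k n) hn hkn
        (s := A' * μ) (u := a' * μ) hl hθ hsu rfl
      rw [hexp, ← hpdef, hμpn, entropyH_exponent, neg_neg, Real.exp_log ha'0] at h
      refine h.trans (add_le_add le_rfl (ENNReal.ofReal_le_ofReal (Real.exp_le_exp.2 ?_)))
      have hq : p * (1 - a') / (1 - p * (1 - a')) ≤ 2 * p := by
        have q1 : p * (1 - a') ≤ p := mul_le_of_le_one_right hp0 (by linarith)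
        have q2 : p * (p * (1 - a')) ≤ p * (1 / 2) :=
          mul_le_mul_of_nonneg_left (q1.trans hp) hp0
        rw [div_le_iff₀ (by linarith)]
        linarith
      have hkq : (k n : ℝ) * (p * (1 - a') / (1 - p * (1 - a'))) ≤ 1 := by
        have e : (k n : ℝ) * (2 * p) ≤ (A' + 1) * μ * (2 * p) :=
          mul_le_mul_of_nonneg_right hkμ (by linarith)
        have e2 : (A' + 1) * μ * (2 * p) ≤ 1 := by
          have : n * ((A' + 1) * μ * (2 * p)) = 2 * (A' + 1) * μ ^ 2 := by rw [← hμpn]; ring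
          have h3 : n * ((A' + 1) * μ * (2 * p)) ≤ n * 1 := by linarith
          exact le_of_mul_le_mul_left h3 hn0
        exact (mul_le_mul_of_nonneg_left hq (Nat.cast_nonneg _)).trans (e.trans e2)
      have he := entropyH_exponent a' μ 0
      linarith

/-- Recovery when the average degree is of smaller order than `log n`. -/
theorem vdRecovers_of_sublogarithmic {d : ℕ} (hd : 1 ≤ d) {r : ℕ → ℝ}
    (hr : ∀ n, 0 < r n ∧ r n < 1 / 4) {k : ℕ → ℕ} (hplant : Plantable k) {ε : ℝ} (hε : 0 < ε)
    (hμ : Tendsto (fun n : ℕ => meanDegree d r n / Real.log n) atTop (𝓝 0))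
    (hkε : ∀ᶠ n : ℕ in atTop, (1 + ε) * (Real.log n / Real.log (Real.log n / meanDegree d r n)) ≤
      (k n : ℝ) - 1) : VDRecovers d r k := by
  -- Any `c` with `1/(1 + ε) < c < 1` works. With `L = log n / μ` and Chernoff parameter `c log L`,
  -- `c < 1` makes `μ L^c = log n · L^(c - 1)` negligible against `log n`, while `c (1 + ε) > 1`
  -- makes `c log L · (k - 1)` exceed `log n` by a fixed factor.
  set c := (1 + ε / 2)⁻¹ with hc
  have hc0 : 0 < c := by positivity
  have hc1 : c < 1 := inv_lt_one_of_one_lt₀ (by linarith)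
  have hcε : 1 < c * (1 + ε) := by
    rw [hc, ← div_eq_inv_mul, one_lt_div (by linarith)]
    linarith
  set η := (c * (1 + ε) - 1) / 2 with hη
  have hη0 : 0 < η := by linarith
  have hE : Tendsto (fun n : ℕ => Real.log n * -η) atTop atBot :=
    tendsto_log_natCast.atTop_mul_const_of_neg (by linarith)
  refine vdRecovers_of_failure_le hplant hE hE ?_
  have hpow : Tendsto (fun n : ℕ => (meanDegree d r n / Real.log n) ^ (1 - c)) atTop (𝓝 0) := by
    have := hμ.rpow_const (p := 1 - c) (Or.inr (by linarith))
    rwa [Real.zero_rpow (by linarith)] at this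
  filter_upwards [hkε, eventually_ge_atTop 1, tendsto_log_natCast.eventually_gt_atTop 0,
    hμ.eventually_lt_const one_pos, hpow.eventually_lt_const hη0] with n hk hn hlog hlt hpw
  refine le_add_right ?_
  have hμ0 : 0 < meanDegree d r n := meanDegree_pos d (fun n => (hr n).1) hn
  have hμp : n * (ballVolume d * r n ^ d) = meanDegree d r n := by rw [meanDegree, mul_assoc]
  set μ := meanDegree d r n
  have hL : 1 < Real.log n / μ := by
    rw [div_lt_one hlog] at hlt
    rwa [one_lt_div hμ0]
  set L := Real.log n / μ with hLdef
  have hlL : 0 < Real.log L := Real.log_pos hL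
  have h := plantedLaw_failure_le_of_le hd (hr n).1.le (hr n).2 (k := k n) (s := k n - 1)
    (l := c * Real.log L) hn (by positivity) le_rfl
  rw [hμp] at h
  refine h.trans (ENNReal.ofReal_le_ofReal (Real.exp_le_exp.2 ?_))
  have h1 : (1 + ε) * Real.log n ≤ Real.log L * (k n - 1) := by
    rw [← mul_div_assoc, div_le_iff₀ hlL] at hk
    linarith
  have h2 : μ * Real.exp (c * Real.log L) = Real.log n * (μ / Real.log n) ^ (1 - c) := by
    have hinv : μ / Real.log n = L⁻¹ := by rw [hLdef, inv_div]
    have hLp : 0 < L := by linarith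
    rw [hinv, Real.inv_rpow hLp.le, ← Real.rpow_neg hLp.le, neg_sub, Real.rpow_sub_one hLp.ne',
      Real.rpow_def_of_pos hLp, mul_comm c, hLdef]
    field_simp
  have h3 : Real.log n * (μ / Real.log n) ^ (1 - c) ≤ Real.log n * η := by gcongr
  have h4 := mul_le_mul_of_nonneg_left h1 hc0.le
  nlinarith

end PlantedRGG

theorem theorem2 (d : ℕ) (hd : 1 ≤ d) (r : ℕ → ℝ) (hr : ∀ n, 0 < r n ∧ r n < 1 / 4)
    (k : ℕ → ℕ) (hk : ∀ n, 2 ≤ k n) (hplant : PlantedRGG.Plantable k)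
    (ε : ℝ) (hε : 0 < ε) :
    (∀ α : ℝ,
      Tendsto (fun n : ℕ => PlantedRGG.meanDegree d r n / Real.log n) atTop (𝓝 α) →
      (∀ᶠ n : ℕ in atTop,
        (1 + ε) * (PlantedRGG.maxDegAsymp α (PlantedRGG.meanDegree d r n) n
          - PlantedRGG.minDegAsymp α (PlantedRGG.meanDegree d r n)) < k n) →
      (α = 0 →
        Tendsto k atTop atTop ∨
        ∀ᶠ n : ℕ in atTop,
          (1 + ε) * (PlantedRGG.maxDegAsymp α (PlantedRGG.meanDegree d r n) n
            - PlantedRGG.minDegAsymp α (PlantedRGG.meanDegree d r n)) < (k n : ℝ) - 1) →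
      PlantedRGG.VDRecovers d r k) ∧
    (Tendsto (fun n : ℕ => PlantedRGG.meanDegree d r n / Real.log n) atTop atTop →
      (∀ᶠ n : ℕ in atTop, ε * PlantedRGG.meanDegree d r n < k n) →
      PlantedRGG.VDRecovers d r k) := by
  refine ⟨fun α hμ hkε hzero => ?_, fun hμ hkε =>
    PlantedRGG.vdRecovers_of_superlogarithmic hd hr hplant hε hμ hkε⟩
  have hα : 0 ≤ α := ge_of_tendsto hμ (by
    filter_upwards [PlantedRGG.tendsto_log_natCast.eventually_gt_atTop 0] with n hn
    exact div_nonneg (PlantedRGG.meanDegree_nonneg d (fun n => (hr n).1) n) hn.le)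
  rcases hα.eq_or_lt with rfl | hα
  · simp only [PlantedRGG.maxDegAsymp, PlantedRGG.minDegAsymp, if_true, zero_lt_one,
      sub_zero] at hkε hzero
    rcases hzero trivial with htop | hk1
    · refine PlantedRGG.vdRecovers_of_sublogarithmic hd hr hplant (half_pos hε) hμ ?_
      have hreal : Tendsto (fun n => (k n : ℝ)) atTop atTop :=
        tendsto_natCast_atTop_atTop.comp htop
      filter_upwards [hkε, (hreal.const_mul_atTop (half_pos hε)).eventually_ge_atTop (1 + ε)]
        with n hn hkn
      set T := Real.log n / Real.log (Real.log n / PlantedRGG.meanDegree d r n)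
      have h1 : (1 + ε) * ((1 + ε / 2) * T) ≤ (1 + ε) * (k n - 1) := by
        have := mul_le_mul_of_nonneg_left hn.le (show 0 ≤ 1 + ε / 2 by linarith)
        linarith
      exact le_of_mul_le_mul_left h1 (by linarith)
    · refine PlantedRGG.vdRecovers_of_sublogarithmic hd hr hplant hε hμ ?_
      filter_upwards [hk1] with n hn using hn.le
  · exact PlantedRGG.vdRecovers_of_logarithmic hd hr hplant hε hα hμ hkε
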